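/- All graphs are finite and simple. A NAC-coloring of a graph $G=(V_G,E_G)$ is a surjective map $\delta\colon E_G\to\{\text{blue},\text{red}\}$ such that no cycle of $G$ has exactly one blue edge and no cycle of $G$ has exactly one red edge. Let $U(G)$ be the set of all pairs $\{u,v\}$ of distinct nonadjacent vertices of $G$ for which there is a path from $u$ to $v$ in $G$ such that, for every NAC-coloring $\delta$ of $G$, all edges of this path have the same color under $\delta$. (If $G$ has no NAC-coloring, every path qualifies.) Put $G_0=G$ and $G_{i+1}=(V_G,E_{G_i}\cup U(G_i))$. This sequence becomes constant as soon as $U(G_n)=\emptyset$; that graph $G_n$ is the constant distance closure of $G$, denoted by $\langle G\rangle$. A graph $L$ is a Laman graph if $|E_L|=2|V_L|-3$ and $|E_H|\le 2|V_H|-3$ for every subgraph $H$ of $L$ with at least one edge. **Theorem.** Let $G$ be a graph with at most $8$ vertices that has a spanning Laman subgraph (a Laman subgraph with the same vertex set as $G$) and such that $\langle G\rangle$ has no vertex of degree two. If $\langle G\rangle$ is not a complete graph, then $\langle G\rangle$ is isomorphic to a spanning subgraph (possibly the whole graph) of one of the graphs $K_{3,3}$, $K_{3,4}$, $K_{3,5}$,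 $K_{4,4}$, $L_1,\dots,L_6$, $Q_1,\dots,Q_6$, $S_1,\dots,S_5$. Here the graph on $n$ vertices in the following list has vertex set $\{0,\dots,n-1\}$, and its edges are listed, $ij$ standing for $\{i,j\}$: - $L_1$ ($6$ vertices): $01, 03, 05, 12, 15, 23, 24, 34, 45$ - $L_2$ ($7$ vertices): $01, 03, 04, 06, 12, 14, 16, 23, 25, 35, 46, 56$ - $L_3$ ($8$ vertices): $04, 05, 06, 07, 12, 13, 16, 17, 23, 25, 27, 34, 37, 45, 46, 56$ - $L_4$ ($8$ vertices): $03, 06, 07, 12, 15, 17, 24, 26, 34, 35, 45, 46, 57, 67$ - $L_5$ ($8$ vertices): $01, 03, 07, 12, 17, 23, 26, 36, 45, 46, 47, 56, 57, 67$ - $L_6$ ($8$ vertices): $01, 02, 07, 12, 16, 25, 34, 35, 36, 37, 45, 46, 47, 56, 57, 67$ - $Q_1$ ($7$ vertices): $03, 04, 05, 12, 14, 15, 23, 26, 36, 46, 56$ - $Q_2$ ($8$ vertices): $04, 05, 06, 12, 13, 16, 25, 27, 34, 37, 47, 57, 67$ - $Q_3$ ($8$ vertices): $02, 03, 07, 12,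 13, 17, 26, 35, 45, 46, 47, 56, 57, 67$ - $Q_4$ ($8$ vertices): $01, 05, 07, 14, 16, 24, 25, 26, 34, 35, 37, 47, 56, 67$ - $Q_5$ ($8$ vertices): $01, 03, 06, 12, 16, 24, 27, 35, 37, 46, 47, 56, 57$ - $Q_6$ ($8$ vertices): $01, 02, 05, 14, 17, 23, 26, 36, 37, 46, 47, 56, 57$ - $S_1$ ($8$ vertices): $03, 06, 07, 12, 15, 17, 24, 26, 34, 35, 45, 47, 56, 67$ - $S_2$ ($8$ vertices): $01, 04, 05, 16, 17, 24, 25, 26, 34, 35, 36, 47, 57, 67$ - $S_3$ ($8$ vertices): $01, 06, 07, 15, 17, 25, 26, 27, 35, 36, 37, 45, 46, 47$ - $S_4$ ($8$ vertices): $01, 03, 05, 12, 14, 23, 25, 34, 36, 37, 45, 46, 47, 67$ - $S_5$ ($8$ vertices): $03, 04, 05, 12, 14, 16, 23, 26, 37, 47, 56, 57, 67$ -/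

import Mathlib

namespace FlexibleGraphs

section Closure

variable {V : Type*}

/-- A walk is unicolor with respect to an edge coloring if all its edges have the same color.
The two colors are `false` (blue) and `true` (red). -/
def IsUnicolor (G : SimpleGraph V) (δ : G.edgeSet → Bool) {u v : V} (p : G.Walk u v) : Prop :=
  ∀ e f : G.edgeSet, (e : Sym2 V) ∈ p.edges → (f : Sym2 V) ∈ p.edges → δ e = δ f

/-- Exactly one edge of the closed walk `c` has the color `b`. For a cycle `c` and `b` blue
(red) this says that `c` is an almost red (almost blue) cycle. -/
def HasExactlyOneEdgeOfColor (G : SimpleGraph V) (δ : G.edgeSet → Bool) (b : Bool) {v : V}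
    (c : G.Walk v v) : Prop :=
  ∃! e : G.edgeSet, (e : Sym2 V) ∈ c.edges ∧ δ e = b

/-- A NAC-coloring: a surjective coloring of the edges by two colors without almost red and
almost blue cycles. -/
def IsNACColoring (G : SimpleGraph V) (δ : G.edgeSet → Bool) : Prop :=
  Function.Surjective δ ∧
    ∀ (v : V) (c : G.Walk v v), c.IsCycle → ∀ b : Bool, ¬ HasExactlyOneEdgeOfColor G δ b c

/-- The nonadjacent pairs of distinct vertices joined by a single path that is unicolor in every
NAC-coloring of `G`. -/
def unicolorPairs (G : SimpleGraph V) : Set (Sym2 V) :=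
  {e | ∃ u v : V, e = s(u, v) ∧ u ≠ v ∧ ¬ G.Adj u v ∧
    ∃ p : G.Walk u v, p.IsPath ∧
      ∀ δ : G.edgeSet → Bool, IsNACColoring G δ → IsUnicolor G δ p}

/-- The graph obtained from `G` by adding all pairs in `unicolorPairs G` as edges. -/
def augment (G : SimpleGraph V) : SimpleGraph V :=
  G ⊔ SimpleGraph.fromEdgeSet (unicolorPairs G)

theorem lt_augment (G : SimpleGraph V) (h : unicolorPairs G ≠ ∅) : G < augment G := by
  refine lt_of_le_of_ne le_sup_left fun heq => ?_
  obtain ⟨e, he⟩ := Set.nonempty_iff_ne_empty.mpr h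
  obtain ⟨u, v, rfl, huv, hadj, -⟩ := id he
  apply hadj
  rw [heq]
  exact Or.inr ((SimpleGraph.fromEdgeSet_adj _).mpr ⟨he, huv⟩)

theorem exists_unicolorPairs_eq_empty [Finite V] (G : SimpleGraph V) :
    ∃ n : ℕ, unicolorPairs (augment^[n] G) = ∅ := by
  by_contra! h
  have hmono : StrictMono fun n : ℕ => augment^[n] G := by
    refine strictMono_nat_of_lt_succ fun n => ?_
    simp only [Function.iterate_succ_apply']
    exact lt_augment _ (Set.nonempty_iff_ne_empty.mp (h n))
  exact not_injective_infinite_finite _ hmono.injective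

open Classical in
/-- The constant distance closure: the graph `G_n` of the sequence `G_0 = G`,
`G_{i+1} = augment G_i`, for the first `n` with `unicolorPairs G_n = ∅` (the sequence is constant
from there on). -/
noncomputable def constantDistanceClosure [Finite V] (G : SimpleGraph V) : SimpleGraph V :=
  augment^[Nat.find (exists_unicolorPairs_eq_empty G)] G

/-- A Laman graph: `|E| = 2|V| - 3`, and `|E_H| ≤ 2|V_H| - 3` for all subgraphs `H` (with at least
one edge). -/
def IsLaman (G : SimpleGraph V) : Prop :=
  G.edgeSet.ncard + 3 = 2 * Nat.card V ∧
    ∀ H : G.Subgraph, H.edgeSet.Nonempty → H.edgeSet.ncard + 3 ≤ 2 * H.verts.ncard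

/-- `G` has a Laman subgraph containing all vertices of `G`. -/
def HasSpanningLamanSubgraph (G : SimpleGraph V) : Prop :=
  ∃ L : SimpleGraph V, L ≤ G ∧ IsLaman L

/-- `G` is isomorphic to a spanning subgraph of `H` (possibly to `H` itself). -/
def IsSpanningSubgraphOf {W : Type*} (G : SimpleGraph V) (H : SimpleGraph W) : Prop :=
  ∃ f : V ≃ W, ∀ u v : V, G.Adj u v → H.Adj (f u) (f v)

end Closure

/-- The graph on the vertices `0, …, n - 1` with the listed edges. -/
def graphOfEdges (n : ℕ) (E : List (Fin n × Fin n)) : SimpleGraph (Fin n) :=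
  SimpleGraph.fromRel fun u v => (u, v) ∈ E

def graphL1 : SimpleGraph (Fin 6) :=
  graphOfEdges 6
    [(0, 1), (0, 3), (0, 5), (1, 2), (1, 5), (2, 3), (2, 4), (3, 4), (4, 5)]

def graphL2 : SimpleGraph (Fin 7) :=
  graphOfEdges 7
    [(0, 1), (0, 3), (0, 4), (0, 6), (1, 2), (1, 4), (1, 6), (2, 3), (2, 5), (3, 5), (4, 6),
    (5, 6)]

def graphL3 : SimpleGraph (Fin 8) :=
  graphOfEdges 8
    [(0, 4), (0, 5), (0, 6), (0, 7), (1, 2), (1, 3), (1, 6), (1, 7), (2, 3), (2, 5), (2, 7),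
    (3, 4), (3, 7), (4, 5), (4, 6), (5, 6)]

def graphL4 : SimpleGraph (Fin 8) :=
  graphOfEdges 8
    [(0, 3), (0, 6), (0, 7), (1, 2), (1, 5), (1, 7), (2, 4), (2, 6), (3, 4), (3, 5), (4, 5),
    (4, 6), (5, 7), (6, 7)]

def graphL5 : SimpleGraph (Fin 8) :=
  graphOfEdges 8
    [(0, 1), (0, 3), (0, 7), (1, 2), (1, 7), (2, 3), (2, 6), (3, 6), (4, 5), (4, 6), (4, 7),
    (5, 6), (5, 7), (6, 7)]

def graphL6 : SimpleGraph (Fin 8) :=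
  graphOfEdges 8
    [(0, 1), (0, 2), (0, 7), (1, 2), (1, 6), (2, 5), (3, 4), (3, 5), (3, 6), (3, 7), (4, 5),
    (4, 6), (4, 7), (5, 6), (5, 7), (6, 7)]

def graphQ1 : SimpleGraph (Fin 7) :=
  graphOfEdges 7
    [(0, 3), (0, 4), (0, 5), (1, 2), (1, 4), (1, 5), (2, 3), (2, 6), (3, 6), (4, 6), (5, 6)]

def graphQ2 : SimpleGraph (Fin 8) :=
  graphOfEdges 8
    [(0, 4), (0, 5), (0, 6), (1, 2), (1, 3), (1, 6), (2, 5), (2, 7), (3, 4), (3, 7), (4, 7),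
    (5, 7), (6, 7)]

def graphQ3 : SimpleGraph (Fin 8) :=
  graphOfEdges 8
    [(0, 2), (0, 3), (0, 7), (1, 2), (1, 3), (1, 7), (2, 6), (3, 5), (4, 5), (4, 6), (4, 7),
    (5, 6), (5, 7), (6, 7)]

def graphQ4 : SimpleGraph (Fin 8) :=
  graphOfEdges 8
    [(0, 1), (0, 5), (0, 7), (1, 4), (1, 6), (2, 4), (2, 5), (2, 6), (3, 4), (3, 5), (3, 7),
    (4, 7), (5, 6), (6, 7)]

def graphQ5 : SimpleGraph (Fin 8) :=
  graphOfEdges 8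
    [(0, 1), (0, 3), (0, 6), (1, 2), (1, 6), (2, 4), (2, 7), (3, 5), (3, 7), (4, 6), (4, 7),
    (5, 6), (5, 7)]

def graphQ6 : SimpleGraph (Fin 8) :=
  graphOfEdges 8
    [(0, 1), (0, 2), (0, 5), (1, 4), (1, 7), (2, 3), (2, 6), (3, 6), (3, 7), (4, 6), (4, 7),
    (5, 6), (5, 7)]

def graphS1 : SimpleGraph (Fin 8) :=
  graphOfEdges 8
    [(0, 3), (0, 6), (0, 7), (1, 2), (1, 5), (1, 7), (2, 4), (2, 6), (3, 4), (3, 5), (4, 5),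
    (4, 7), (5, 6), (6, 7)]

def graphS2 : SimpleGraph (Fin 8) :=
  graphOfEdges 8
    [(0, 1), (0, 4), (0, 5), (1, 6), (1, 7), (2, 4), (2, 5), (2, 6), (3, 4), (3, 5), (3, 6),
    (4, 7), (5, 7), (6, 7)]

def graphS3 : SimpleGraph (Fin 8) :=
  graphOfEdges 8
    [(0, 1), (0, 6), (0, 7), (1, 5), (1, 7), (2, 5), (2, 6), (2, 7), (3, 5), (3, 6), (3, 7),
    (4, 5), (4, 6), (4, 7)]

def graphS4 : SimpleGraph (Fin 8) :=
  graphOfEdges 8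
    [(0, 1), (0, 3), (0, 5), (1, 2), (1, 4), (2, 3), (2, 5), (3, 4), (3, 6), (3, 7), (4, 5),
    (4, 6), (4, 7), (6, 7)]

def graphS5 : SimpleGraph (Fin 8) :=
  graphOfEdges 8
    [(0, 3), (0, 4), (0, 5), (1, 2), (1, 4), (1, 6), (2, 3), (2, 6), (3, 7), (4, 7), (5, 6),
    (5, 7), (6, 7)]

end FlexibleGraphs

namespace FlexibleGraphs

/-! Only a few properties of the closure $H=\langle G\rangle$ are needed. It contains a spanning
Laman graph and has no unicolor pairs. A noncomplete $H$ has at least three vertices, so Laman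
sparsity gives every vertex degree at least two, and excluding degree two leaves minimum degree at
least three (`IsLaman.two_le_card_adj`). Sparsity also rules out a cut vertex (`Realizes.not_cut`).

The absence of unicolor pairs is used only for paths of length two: if two incident edges have equal
colors in every NAC-coloring, their outer ends are adjacent. Triangles are monochromatic and
4-cycles have even color sum, so color equalities follow by linear algebra modulo two. Two
consequences suffice: two triangles sharing an edge span a $K_4$ (`adj_of_adjacent_triangles`), and
one pattern on seven vertices forces an edge (`adj_of_pattern`).

The rest is a finite enumeration. The $K_4$ condition passes to induced subgraphs. Deleting a vertex
lowers every other degree by at most one, so the bound "minimum degree at least $n-5$" is inherited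
from $n$ to $n-1$ vertices, and for $n\le 8$ it follows from minimum degree three. Hence all
candidates arise by repeatedly adding a vertex of minimum degree, up to isomorphism
(`exists_realizes`). By `reps_classification`, each resulting graph has a vertex of degree below
three, is complete, lies in a listed graph, has a cut vertex or is disconnected, or contains the
seven-vertex pattern without its forced edge. -/

theorem le_constantDistanceClosure {V : Type*} [Finite V] (G : SimpleGraph V) :
    G ≤ constantDistanceClosure G := by
  rw [constantDistanceClosure]
  generalize Nat.find (exists_unicolorPairs_eq_empty G) = n
  induction n with
  | zero => exact le_rfl
  | succ n ih =>
    rw [Function.iterate_succ_apply']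
    exact ih.trans le_sup_left

theorem unicolorPairs_constantDistanceClosure {V : Type*} [Finite V] (G : SimpleGraph V) :
    unicolorPairs (constantDistanceClosure G) = ∅ := by
  classical
  exact Nat.find_spec (exists_unicolorPairs_eq_empty G)

/-! ### Color relations from short cycles, and the edges they force -/

section Coloring

variable {V : Type*} {G : SimpleGraph V} {δ : G.edgeSet → Bool}

open Classical in
/-- The color of an edge, extended by `false` to all pairs of vertices. -/
noncomputable def edgeColor (δ : G.edgeSet → Bool) (e : Sym2 V) : Bool :=
  -- The default value plays no role: colors are compared only on edges. Totality lets colors be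
  -- treated as free Boolean variables.
  if h : e ∈ G.edgeSet then δ ⟨e, h⟩ else false

theorem edgeColor_of_mem (δ : G.edgeSet → Bool) {e : Sym2 V} (h : e ∈ G.edgeSet) :
    edgeColor δ e = δ ⟨e, h⟩ := by
  rw [edgeColor, dif_pos h]

/-- Otherwise this edge would be the only one of its color on the cycle. In this form the condition
on a short cycle becomes a finite case check. -/
theorem IsNACColoring.exists_edge_of_same_color (hδ : IsNACColoring G δ) {v : V} {c : G.Walk v v}
    (hc : c.IsCycle) {e : Sym2 V} (h : e ∈ c.edges) :
    ∃ f ∈ c.edges, f ≠ e ∧ edgeColor δ e = edgeColor δ f := by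
  have he : e ∈ G.edgeSet := c.edges_subset_edgeSet h
  by_contra! hne
  refine hδ.2 v c hc (edgeColor δ e) ⟨⟨e, he⟩, ⟨h, (edgeColor_of_mem δ he).symm⟩, ?_⟩
  rintro ⟨f, hf⟩ ⟨hfc, hcol⟩
  by_contra hfe
  refine hne f hfc (fun h => hfe (Subtype.ext h)) ?_
  rw [edgeColor_of_mem δ hf, hcol]

theorem IsNACColoring.triangle (hδ : IsNACColoring G δ) {a b c : V} (hab : G.Adj a b)
    (hbc : G.Adj b c) (hca : G.Adj c a) : edgeColor δ s(a, b) = edgeColor δ s(b, c) := by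
  have hc : (SimpleGraph.Walk.cons hab (.cons hbc (.cons hca .nil))).IsCycle := by
    simp [SimpleGraph.Walk.cons_isCycle_iff, hab.ne, hab.ne', hbc.ne, hca.ne, hca.ne']
  have key : ∀ e ∈ [s(a, b), s(b, c), s(c, a)], ∃ f ∈ [s(a, b), s(b, c), s(c, a)],
    f ≠ e ∧ edgeColor δ e = edgeColor δ f := fun e he => hδ.exists_edge_of_same_color hc he
  simp only [List.mem_cons, List.not_mem_nil, or_false, forall_eq_or_imp, forall_eq] at key
  obtain ⟨⟨f1, m1, n1, c1⟩, ⟨f2, m2, n2, c2⟩, f3, m3, n3, c3⟩ := key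
  have d1 : edgeColor δ s(a, b) = edgeColor δ s(b, c) ∨
      edgeColor δ s(a, b) = edgeColor δ s(c, a) := by
    rcases m1 with rfl | rfl | rfl
    exacts [absurd rfl n1, Or.inl c1, Or.inr c1]
  have d2 : edgeColor δ s(b, c) = edgeColor δ s(a, b) ∨
      edgeColor δ s(b, c) = edgeColor δ s(c, a) := by
    rcases m2 with rfl | rfl | rfl
    exacts [Or.inl c2, absurd rfl n2, Or.inr c2]
  rcases d1 with d | d
  · exact d
  · rcases d2 with d' | d'
    · exact d'.symm
    · exact d.trans d'.symm

/-- No color occurs exactly once among four edges, so each occurs 0, 2 or 4 times. The parity form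
allows relations of several cycles to be added. -/
theorem IsNACColoring.fourCycle (hδ : IsNACColoring G δ) {a b c d : V} (hab : G.Adj a b)
    (hbc : G.Adj b c) (hcd : G.Adj c d) (hda : G.Adj d a) (hac : a ≠ c) (hbd : b ≠ d) :
    (edgeColor δ s(a, b) ^^ edgeColor δ s(b, c) ^^ edgeColor δ s(c, d) ^^ edgeColor δ s(d, a)) =
      false := by
  have hc : (SimpleGraph.Walk.cons hab (.cons hbc (.cons hcd (.cons hda .nil)))).IsCycle := by
    simp [SimpleGraph.Walk.cons_isCycle_iff, hab.ne, hab.ne', hbc.ne, hcd.ne, hda.ne, hda.ne',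
      hac, hac.symm, hbd]
  have key : ∀ e ∈ [s(a, b), s(b, c), s(c, d), s(d, a)],
    ∃ f ∈ [s(a, b), s(b, c), s(c, d), s(d, a)], f ≠ e ∧ edgeColor δ e = edgeColor δ f :=
    fun e he => hδ.exists_edge_of_same_color hc he
  simp only [List.mem_cons, List.not_mem_nil, or_false, forall_eq_or_imp, forall_eq] at key
  obtain ⟨⟨f1, m1, n1, c1⟩, ⟨f2, m2, n2, c2⟩, ⟨f3, m3, n3, c3⟩, f4, m4, n4, c4⟩ := key
  have d1 : edgeColor δ s(a, b) = edgeColor δ s(b, c) ∨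
      edgeColor δ s(a, b) = edgeColor δ s(c, d) ∨ edgeColor δ s(a, b) = edgeColor δ s(d, a) := by
    rcases m1 with rfl | rfl | rfl | rfl
    exacts [absurd rfl n1, Or.inl c1, Or.inr (Or.inl c1), Or.inr (Or.inr c1)]
  have d2 : edgeColor δ s(b, c) = edgeColor δ s(a, b) ∨
      edgeColor δ s(b, c) = edgeColor δ s(c, d) ∨ edgeColor δ s(b, c) = edgeColor δ s(d, a) := by
    rcases m2 with rfl | rfl | rfl | rfl
    exacts [Or.inl c2, absurd rfl n2, Or.inr (Or.inl c2), Or.inr (Or.inr c2)]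
  have d3 : edgeColor δ s(c, d) = edgeColor δ s(a, b) ∨
      edgeColor δ s(c, d) = edgeColor δ s(b, c) ∨ edgeColor δ s(c, d) = edgeColor δ s(d, a) := by
    rcases m3 with rfl | rfl | rfl | rfl
    exacts [Or.inl c3, Or.inr (Or.inl c3), absurd rfl n3, Or.inr (Or.inr c3)]
  have d4 : edgeColor δ s(d, a) = edgeColor δ s(a, b) ∨
      edgeColor δ s(d, a) = edgeColor δ s(b, c) ∨ edgeColor δ s(d, a) = edgeColor δ s(c, d) := by
    rcases m4 with rfl | rfl | rfl | rfl
    exacts [Or.inl c4, Or.inr (Or.inl c4), Or.inr (Or.inr c4), absurd rfl n4]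
  revert d1 d2 d3 d4
  generalize edgeColor δ s(a, b) = x, edgeColor δ s(b, c) = y, edgeColor δ s(c, d) = z,
    edgeColor δ s(d, a) = w
  revert x y z w
  decide

/-- Were the ends nonadjacent, the path `a`, `b`, `c` would be a witness that they form a unicolor
pair. -/
theorem adj_of_edgeColor_eq (hG : unicolorPairs G = ∅) {a b c : V} (hab : G.Adj a b)
    (hbc : G.Adj b c) (hac : a ≠ c)
    (h : ∀ δ, IsNACColoring G δ → edgeColor δ s(a, b) = edgeColor δ s(b, c)) : G.Adj a c := by
  by_contra hn
  have hmem : s(a, c) ∈ unicolorPairs G := by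
    refine ⟨a, c, rfl, hac, hn, .cons hab (.cons hbc .nil), ?_, fun δ hδ => ?_⟩
    · simp [hab.ne, hbc.ne, hac]
    · have e := h δ hδ
      rw [edgeColor_of_mem δ hab, edgeColor_of_mem δ hbc] at e
      rintro ⟨e1, h1⟩ ⟨e2, h2⟩ m1 m2
      simp only [SimpleGraph.Walk.edges_cons, SimpleGraph.Walk.edges_nil, List.mem_cons,
        List.not_mem_nil, or_false] at m1 m2
      rcases m1 with rfl | rfl <;> rcases m2 with rfl | rfl <;> first | rfl | exact e | exact e.symm
  rw [hG] at hmem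
  exact hmem

/-- In a graph without unicolor pairs, adjacent triangles lie in a complete graph. -/
theorem adj_of_adjacent_triangles (hG : unicolorPairs G = ∅) {a b c d : V} (hab : G.Adj a b)
    (hca : G.Adj c a) (hcb : G.Adj c b) (hda : G.Adj d a) (hdb : G.Adj d b) (hcd : c ≠ d) :
    G.Adj c d := by
  refine adj_of_edgeColor_eq hG hca hda.symm hcd fun δ hδ => ?_
  rw [hδ.triangle hca hab hcb.symm, Sym2.eq_swap (a := a) (b := d), hδ.triangle hda hab hdb.symm]

/-- The colors of `ab` and `ac` agree, since the sum of the four-cycles `abdc`, `bdge`, `cdgf` and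
`aegf` gives a linear relation modulo two between them and the triangles `abe` and `acf`. -/
theorem adj_of_pattern (hG : unicolorPairs G = ∅) {a b c d e f g : V} (hab : G.Adj a b)
    (hac : G.Adj a c) (hbd : G.Adj b d) (hcd : G.Adj c d) (hae : G.Adj a e) (hbe : G.Adj b e)
    (haf : G.Adj a f) (hcf : G.Adj c f) (hdg : G.Adj d g) (heg : G.Adj e g) (hfg : G.Adj f g)
    (had : a ≠ d) (hag : a ≠ g) (hbc : b ≠ c) (hbg : b ≠ g) (hcg : c ≠ g) (hde : d ≠ e)
    (hdf : d ≠ f) (hef : e ≠ f) : G.Adj b c := by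
  refine adj_of_edgeColor_eq hG hab.symm hac hbc fun δ hδ => ?_
  have t1 := hδ.triangle hab hbe hae.symm
  have t2 := hδ.triangle hbe hae.symm hab
  have t3 := hδ.triangle hac hcf haf.symm
  have t4 := hδ.triangle hcf haf.symm hac
  have q1 := hδ.fourCycle hab hbd hcd.symm hac.symm had hbc
  have q2 := hδ.fourCycle hbd hdg heg.symm hbe.symm hbg hde
  have q3 := hδ.fourCycle hcd hdg hfg.symm hcf.symm hcg hdf
  have q4 := hδ.fourCycle hae heg hfg.symm haf.symm hag hef
  rw [Sym2.eq_swap (a := d), Sym2.eq_swap (a := c) (b := a)] at q1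
  rw [Sym2.eq_swap (a := g), Sym2.eq_swap (a := e) (b := b)] at q2
  rw [Sym2.eq_swap (a := g), Sym2.eq_swap (a := f) (b := c)] at q3
  rw [Sym2.eq_swap (a := a) (b := e), Sym2.eq_swap (a := g)] at q4
  rw [Sym2.eq_swap (a := b) (b := a)]
  revert t1 t2 t3 t4 q1 q2 q3 q4
  generalize edgeColor δ s(a, b) = x1, edgeColor δ s(b, e) = x2, edgeColor δ s(e, a) = x3,
    edgeColor δ s(a, c) = x4, edgeColor δ s(c, f) = x5, edgeColor δ s(f, a) = x6,
    edgeColor δ s(b, d) = x7, edgeColor δ s(c, d) = x8, edgeColor δ s(d, g) = x9,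
    edgeColor δ s(e, g) = y1, edgeColor δ s(f, g) = y2
  rintro rfl rfl rfl rfl
  revert x1 x4 x7 x8 x9 y1 y2
  decide

end Coloring

/-! ### Sparsity: degrees and size of Laman graphs -/

/-- Two sets of at least two vertices each that together span all edges of a Laman graph have total
size at least `|V| + 2`. -/
theorem IsLaman.card_add_two_le {V : Type*} [Fintype V] {L : SimpleGraph V} (hL : IsLaman L)
    {A B : Finset V} (hA : 2 ≤ A.card) (hB : 2 ≤ B.card)
    (h : ∀ u v, L.Adj u v → (u ∈ A ∧ v ∈ A) ∨ (u ∈ B ∧ v ∈ B)) :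
    Fintype.card V + 2 ≤ A.card + B.card := by
  -- The Laman bound assumes an edge; for an edgeless induced subgraph the inequality still holds
  -- because `C` has at least two elements.
  have key : ∀ C : Finset V, 2 ≤ C.card →
      ((⊤ : L.Subgraph).induce C).edgeSet.ncard + 3 ≤ 2 * C.card := fun C hC => by
    rcases Set.eq_empty_or_nonempty ((⊤ : L.Subgraph).induce (C : Set V)).edgeSet with h0 | h0
    · rw [h0, Set.ncard_empty]
      omega
    · have := hL.2 _ h0
      rwa [SimpleGraph.Subgraph.induce_verts, Set.ncard_coe_finset] at this
  have hsub : L.edgeSet ⊆ ((⊤ : L.Subgraph).induce A).edgeSet ∪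
      ((⊤ : L.Subgraph).induce B).edgeSet := fun e => by
    induction e using Sym2.ind with
    | h u v =>
      intro huv
      rcases h u v huv with h' | h'
      · exact Or.inl ⟨h'.1, h'.2, huv⟩
      · exact Or.inr ⟨h'.1, h'.2, huv⟩
  -- Counting edges gives $2|V|-3\le(2|A|-3)+(2|B|-3)$, that is $2|A|+2|B|\ge 2|V|+3$; parity
  -- improves 3 to 4.
  have h1 := (Set.ncard_le_ncard hsub (Set.toFinite _)).trans (Set.ncard_union_le _ _)
  have h2 := hL.1
  rw [Nat.card_eq_fintype_card] at h2
  have := key A hA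
  have := key B hB
  omega

open Classical in
-- If `v` had at most one neighbor, a 2-set containing `v` and its neighbors, together with the
-- complement of `v`, would span all edges with total size only $|V|+1$.
theorem IsLaman.two_le_card_adj {V : Type*} [Fintype V] {L : SimpleGraph V} (hL : IsLaman L)
    (h3 : 3 ≤ Fintype.card V) (v : V) : 2 ≤ (Finset.univ.filter (L.Adj v)).card := by
  by_contra hlt
  have hA : ∃ A : Finset V, A.card = 2 ∧ insert v (Finset.univ.filter (L.Adj v)) ⊆ A := by
    obtain ⟨A, hA, -, hc⟩ := Finset.exists_subsuperset_card_eq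
      (Finset.subset_univ (insert v (Finset.univ.filter (L.Adj v)))) (n := 2)
      ((Finset.card_insert_le _ _).trans (by omega)) (by rw [Finset.card_univ]; omega)
    exact ⟨A, hc, hA⟩
  obtain ⟨A, hc, hA⟩ := hA
  have hB : (Finset.univ.erase v).card = Fintype.card V - 1 := by
    rw [Finset.card_erase_of_mem (Finset.mem_univ v), Finset.card_univ]
  have := hL.card_add_two_le (A := A) (B := Finset.univ.erase v) (by omega)
    (by omega) fun x y hxy => by
    by_cases hx : x = v
    · subst hx
      exact Or.inl ⟨hA (by simp), hA (by simp [hxy])⟩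
    · by_cases hy : y = v
      · subst hy
        exact Or.inl ⟨hA (by simp [hxy.symm]), hA (by simp)⟩
      · exact Or.inr ⟨by simp [hx], by simp [hy]⟩
  omega

/-- The equation $|E|+3=2|V|$ excludes fewer than two vertices, and on two vertices it gives one
edge, hence a complete graph. -/
theorem IsLaman.three_le_card {V : Type*} [Fintype V] {L : SimpleGraph V} (hL : IsLaman L)
    (htop : L ≠ ⊤) : 3 ≤ Fintype.card V := by
  by_contra hlt
  have h := hL.1
  rw [Nat.card_eq_fintype_card] at h
  have h2 : Fintype.card V = 2 := by omega
  obtain ⟨e, he⟩ : L.edgeSet.Nonempty := by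
    rw [← Set.ncard_pos (Set.toFinite _)]
    omega
  induction e using Sym2.ind with
  | h a b =>
    classical
    have hab : L.Adj a b := he
    have huniv : ({a, b} : Finset V) = Finset.univ :=
      Finset.eq_univ_of_card _ (by rw [Finset.card_pair hab.ne, h2])
    have hmem : ∀ x : V, x = a ∨ x = b := fun x => by
      have := Finset.mem_univ x
      rw [← huniv] at this
      simpa using this
    apply htop
    ext x y
    rw [SimpleGraph.top_adj]
    refine ⟨fun h => h.ne, fun h => ?_⟩
    rcases hmem x with rfl | rfl <;> rcases hmem y with rfl | rfl
    · exact absurd rfl h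
    · exact hab
    · exact hab.symm
    · exact absurd rfl h

/-! ### Graphs as bit codes and the enumeration by vertex addition -/

/-- Bit `k` of `x`. -/
def bit (x k : ℕ) : Bool := Nat.beq (Nat.land 1 (Nat.shiftRight x k)) 1

/-- Evaluates `x` before passing it on to `p`. -/
noncomputable def withValue (x : ℕ) (p : ℕ → Bool) : Bool :=
  -- The case distinction on `x` forces it to a numeral, so that `p` does not recompute it at every
  -- use.
  Nat.rec (p 0) (fun k _ => p (Nat.succ k)) x

/-- `p` holds for all numbers below `n`. -/
noncomputable def allBelow (n : ℕ) (p : ℕ → Bool) : Bool :=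
  Nat.rec true (fun k ih => p k && ih) n

/-- `p` holds for some number below `n`. -/
noncomputable def anyBelow (n : ℕ) (p : ℕ → Bool) : Bool :=
  Nat.rec false (fun k ih => p k || ih) n

/-- The number of ones among the last eight binary digits. -/
def popCount (x : ℕ) : ℕ :=
  -- For $x<256$ the factor $\sum_{i<8}2^{8i}$ makes eight copies of `x`, the mask
  -- $\sum_{i<8}2^{9i}$ keeps bit $i$ of copy $i$, and reduction modulo $2^9-1$ adds the base-$2^9$
  -- digits.
  Nat.mod (Nat.land (Nat.mul x 72340172838076673) 9241421688590303745) 511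

/-- The adjacency code: the bit `8 * i + j` of `g` tells whether `i` and `j` are adjacent. -/
def adj (g i j : ℕ) : Bool := bit g (Nat.add (Nat.mul 8 i) j)

/-- The set of neighbors below `n` of the vertex `i`. -/
def row (n g i : ℕ) : ℕ := Nat.mod (Nat.shiftRight g (Nat.mul 8 i)) (Nat.pow 2 n)

/-- Moves bit `i` of a seven-bit number to position `8 * i`. -/
def spread (m : ℕ) : ℕ := Nat.land (Nat.mul m 567382630219905) 72340172838076673

/-- The code of the graph with an additional vertex `n` with neighborhood `m`. -/
def extend (n g m : ℕ) : ℕ :=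
  Nat.lor (Nat.lor g (Nat.shiftLeft (spread m) n)) (Nat.shiftLeft m (Nat.mul 8 n))

/-- The additional vertex would have at least degree `n - 4`, and no vertex a smaller degree. -/
noncomputable def degreeTest (n g m : ℕ) : Bool :=
  -- This is the bound $n'-5$ for the enlarged graph with $n'=n+1$ vertices.
  Nat.ble (Nat.sub n 4) (popCount m) &&
    allBelow n fun i => Nat.ble (popCount m)
      (Nat.add (popCount (row n g i)) (Nat.land 1 (Nat.shiftRight m i)))

/-- No two adjacent triangles, one of them at the additional vertex, span a non-complete graph. -/
noncomputable def diamondTest (n g m : ℕ) : Bool :=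
  allBelow n fun i => !bit m i || allBelow n fun j => !bit m j || !adj g i j ||
    -- The inclusion from left to right concerns triangles sharing the edge `i j`, the reverse one
    -- triangles sharing the edge from `i` to the new vertex.
    Nat.beq (Nat.lor (Nat.land (row n g i) (row n g j)) (Nat.pow 2 j)) (Nat.land (row n g i) m)

/-- An isomorphism invariant, used to speed up the search only. -/
noncomputable def invariant (n g : ℕ) : ℕ :=
  Nat.rec 0 (fun i s => Nat.add s (Nat.rec 0 (fun j s' => Nat.add s' (cond (adj g i j)
    (Nat.mul (popCount (row n g i)) (popCount (row n g j))) 0)) n)) n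

/-- Search for an isomorphism of `r` to `c` that extends the partial map given by a list of
pairs. -/
noncomputable def isoFrom (n r c : ℕ) (k : ℕ) : List (ℕ × ℕ) → Bool :=
  Nat.rec (fun _ => true) (fun k ih q => anyBelow n fun x =>
    Nat.beq (popCount (row n r k)) (popCount (row n c x)) &&
    q.all (fun p => !Nat.beq x p.2 && (adj r k p.1 == adj c x p.2)) &&
    ih ((k, x) :: q)) k

/-- Search for an isomorphism of `r` to `c`. -/
noncomputable def isoTest (n r c : ℕ) : Bool :=
  Nat.beq (invariant n r) (invariant n c) && isoFrom n r c n []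

/-- Codes of the graphs on `n` vertices with minimum degree at least `n - 5` in which adjacent
triangles lie in a complete graph, one for each isomorphism class. -/
def reps : ℕ → List ℕ
  | 0 => [0]
  | 1 => [0]
  | 2 => [0, 258]
  | 3 => [0, 258, 65798, 197894]
  | 4 =>
    [0, 258, 67633410, 65798, 16843022, 33622278, 101255430, 197894, 16975118, 118164750]
  | 5 =>
    [0, 258, 67633410, 4362600722, 65798, 16843022, 4311810334, 8606781710, 33622278,
     17214540038, 51842713862, 101255430, 4396222742, 12986161430, 25872111878, 197894,
     34628371718, 16975118, 4311942430, 8606913806, 34645148942, 38940116254, 118164750,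
     4413132062, 64812162334]
  | 6 =>
    [17729692631298, 1103874228530, 2203385864466, 4402411208978, 1103823438142, 2203335074078,
     2207630045454, 4406655389966, 17738231779598, 8813844433158, 26543469431046, 1151354341670,
     3350377605414, 6648914585862, 17729726253318, 1103907850550, 2203419486486, 8801026115862,
     17734021220630, 18833532848438, 19933044484374, 1112497789238, 4411034769686,
     5510546397494, 6610058033430, 13207664662806, 17742611159318, 22140659767574,
     21080053523754, 1125383739686, 2224895375622, 6622943983878, 9922013632806, 7726767290424,
     1134139999526, 8831258264838, 26560883262726, 1103823570238, 2203335206174, 8800941835550,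
     4406655522062, 8805236806926, 8831275042062, 17764270146830, 26560900039950, 1138451744062,
     2237963379998, 17729743162638, 1103924759870, 2203436395806, 17734038129950,
     18833549757758, 19933061393694, 1164323790142, 34287650553150]
  | 7 =>
    [13590256348629254, 870968399579462, 1715393333905670, 3404244267895046, 9360194329971046,
     9641669306698022, 1410725265353062, 1692200242080038, 3381051176069414, 4788699859593574,
     5633124793919782, 10206818287560998, 13584792881801510, 1695498779060486, 2539924778723654,
     3384349713049862, 9365691890215238, 13599172230449414, 13582546412046646,
     13599176525416726, 863258462996854, 1707683397323062, 2552109396986230, 2833584373713206,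
     5085657991563574, 864357974632790, 1708782908958998, 3397633842948374, 5649707460798742,
     13582555001985334, 1694360410872118, 2538786410535286, 2820261387262262, 5635284962711862,
     6761185939102006, 13586953050593590, 15838753938020662, 1695459922508054, 2539885922171222,
     3384310856497430, 5636384474347798, 6762285450737942, 11335978944379158, 16962454807000120,
     5642982080977174, 13594650168858902, 13599185115355414, 6777816052472086,
     11351509546113302, 1438312177408342, 1719787154135318, 14439075082294618, 1695472808458502,
     2539898808121670, 4795271495620966, 13591364517828902, 872076568779110, 1716501503105318,
     1978051608475768, 2559836747400518, 2559836764177742, 9360181427373438, 13599172247358734,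
     13582546428955966, 13583645940591902, 13599176542326046, 5085658008472894,
     13881751030664574, 5086757520108830, 5649707477708062, 13601375565589790, 9360207299419518,
     9641682276146494, 17837855883361662]
  | 8 =>
    [1808789952501335430, 4865323749552071880, 806783465573500080, 1012477619692679280,
     8972161708569283696, 2528096555313046728, 8693848901306438712, 4338031612937782602,
     1384933590414498230, 2033451938911689014, 4051205309453637942, 5312071917873207734,
     6450858422751482274, 4196441995063431462, 5948707058930991410, 4874401317550990536,
     8337527267345534092, 6459935990750400930, 8254690805633040690, 2241982140694700482,
     1812221175304049058, 8339770271637079434, 7175811370759398600, 6027323371913651400,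
     1094750096415427824, 1095313046368865520, 3606975990186688818, 939852711744008432,
     6383876570140513578, 794620419313299696, 506381209882392824, 508641841909919984,
     1085102596360827120, 1022688069700717680, 1094745663738645744, 951197858225343728,
     1094745698366819568, 7035116363485748734, 8771566117276829062, 9205322385119247870]
  | _ => []

/-- Each graph obtained from one in `reps n` by adding a vertex of minimum degree is isomorphic to
one in `reps (n + 1)`, unless it violates one of the conditions. -/
noncomputable def extensionTest (n : ℕ) : Bool :=
  (reps n).all fun g => allBelow (Nat.pow 2 n) fun m =>
    !degreeTest n g m || !diamondTest n g m ||
      withValue (extend n g m) fun c => (reps (n + 1)).any fun r => isoTest (n + 1) r c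

theorem extensionTest_0 : extensionTest 0 = true := by
  decide +kernel

theorem extensionTest_1 : extensionTest 1 = true := by
  decide +kernel

theorem extensionTest_2 : extensionTest 2 = true := by
  decide +kernel

theorem extensionTest_3 : extensionTest 3 = true := by
  decide +kernel

theorem extensionTest_4 : extensionTest 4 = true := by
  decide +kernel

theorem extensionTest_5 : extensionTest 5 = true := by
  decide +kernel

theorem extensionTest_6 : extensionTest 6 = true := by
  decide +kernel

theorem extensionTest_7 : extensionTest 7 = true := by
  decide +kernel

/-! ### Correctness of the bit operations -/

theorem bit_eq (x k : ℕ) : bit x k = x.testBit k := by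
  have h : Nat.land 1 (Nat.shiftRight x k) = 1 &&& (x >>> k) := rfl
  rw [bit, h, Nat.testBit, Nat.one_and_eq_mod_two]
  rcases Nat.mod_two_eq_zero_or_one (x >>> k) with h | h <;> rw [h] <;> rfl

theorem allBelow_iff (n : ℕ) (p : ℕ → Bool) : allBelow n p = true ↔ ∀ i < n, p i = true := by
  induction n with
  | zero => simp [allBelow]
  | succ n ih =>
    have h : allBelow (n + 1) p = (p n && allBelow n p) := rfl
    rw [h, Bool.and_eq_true, ih, Nat.forall_lt_succ_right, and_comm]

theorem anyBelow_iff (n : ℕ) (p : ℕ → Bool) : anyBelow n p = true ↔ ∃ i < n, p i = true := by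
  induction n with
  | zero => simp [anyBelow]
  | succ n ih =>
    have h : anyBelow (n + 1) p = (p n || anyBelow n p) := rfl
    rw [h, Bool.or_eq_true, ih, Nat.exists_lt_succ_right, or_comm]

theorem withValue_eq (x : ℕ) (p : ℕ → Bool) : withValue x p = p x := by
  cases x <;> rfl

theorem adj_eq (g i j : ℕ) : adj g i j = g.testBit (8 * i + j) := bit_eq _ _

theorem testBit_row (n g i j : ℕ) :
    (row n g i).testBit j = (decide (j < n) && adj g i j) := by
  have h : row n g i = (g >>> (8 * i)) % 2 ^ n := rfl
  rw [h, Nat.testBit_mod_two_pow, Nat.testBit_shiftRight, adj_eq]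

theorem row_lt (n g i : ℕ) : row n g i < 2 ^ n := Nat.mod_lt _ (Nat.two_pow_pos n)

theorem popCount_eq : ∀ x < 256, popCount x = ((Finset.range 8).filter fun i => x.testBit i).card := by
  decide +kernel

theorem popCount_eq_card {n x : ℕ} (hn : n ≤ 8) (hx : x < 2 ^ n) :
    popCount x = ((Finset.range n).filter fun i => x.testBit i).card := by
  rw [popCount_eq x (hx.trans_le (Nat.pow_le_pow_right (by norm_num) hn))]
  congr 1
  ext i
  simp only [Finset.mem_filter, Finset.mem_range]
  refine ⟨fun ⟨_, h⟩ => ⟨?_, h⟩, fun ⟨h', h⟩ => ⟨by omega, h⟩⟩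
  by_contra h'
  rw [Nat.testBit_lt_two_pow (hx.trans_le (Nat.pow_le_pow_right (by norm_num) (not_lt.mp h')))] at h
  exact absurd h (by simp)

theorem testBit_spread : ∀ m < 128, ∀ k < 64,
    (spread m).testBit k = (decide (k % 8 = 0) && m.testBit (k / 8)) := by
  decide +kernel

theorem adj_extend {n g m i j : ℕ} (hn : n ≤ 7) (hg : g < 2 ^ (8 * n))
    (hcol : ∀ i < n, adj g i n = false) (hm : m < 2 ^ n) (hi : i ≤ n) (hj : j ≤ n) :
    adj (extend n g m) i j = if i = n then m.testBit j else
      if j = n then m.testBit i else adj g i j := by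
  have hext : extend n g m = g ||| (spread m) <<< n ||| m <<< (8 * n) := rfl
  have hmn : ∀ k, n ≤ k → m.testBit k = false := fun k hk =>
    Nat.testBit_lt_two_pow (hm.trans_le (Nat.pow_le_pow_right (by norm_num) hk))
  have hgn : ∀ k, 8 * n ≤ k → g.testBit k = false := fun k hk =>
    Nat.testBit_lt_two_pow (hg.trans_le (Nat.pow_le_pow_right (by norm_num) hk))
  have hm' : m < 128 := hm.trans_le (Nat.pow_le_pow_right (by norm_num) hn)
  rw [adj_eq, hext, Nat.testBit_or, Nat.testBit_or, Nat.testBit_shiftLeft, Nat.testBit_shiftLeft,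
    testBit_spread m hm' _ (by omega)]
  -- Shifted by `n`, the spread bits occupy positions congruent to `n` modulo 8, which is column `n`
  -- since `n ≤ 7`. The old code and the new row do not meet that column, except at the diagonal bit
  -- of `m`, which vanishes.
  split_ifs with h1 h2
  · subst h1
    rw [hgn _ (by omega)]
    have e : 8 * i + j - 8 * i = j := by omega
    rw [e]
    by_cases hj' : j = i
    · subst hj'
      simp [hmn j le_rfl]
    · have : ¬ (8 * i + j - i) % 8 = 0 := by omega
      simp [this]
  · subst h2
    have e : 8 * i + j - j = 8 * i := by omega
    have e' : ¬ 8 * i + j ≥ 8 * j := by omega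
    have := hcol i (by omega)
    rw [adj_eq] at this
    rw [this, e]
    simp [e']
  · have e' : ¬ 8 * i + j ≥ 8 * n := by omega
    rw [adj_eq]
    by_cases h3 : 8 * i + j ≥ n
    · have : ¬ (8 * i + j - n) % 8 = 0 := by omega
      simp [this, e']
    · simp [h3, e']

/-! ### Codes realized by induced subgraphs -/

/-- The subgraph of `H` induced by `f 0, …, f (n - 1)` has the code `g`. -/
structure Realizes {V : Type*} (H : SimpleGraph V) (f : ℕ → V) (n g : ℕ) : Prop where
  inj : ∀ i < n, ∀ j < n, f i = f j → i = j
  adj_iff : ∀ i < n, ∀ j < n, adj g i j = true ↔ H.Adj (f i) (f j)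

/-- Vertices are assigned downwards from `k - 1`, so the list `q` carries the constraints imposed by
larger indices. The degree comparison only prunes the search and is discarded. Adjacency is recorded
for `j < i` alone; symmetry of `r` supplies the rest in `Realizes.of_isoTest`. -/
theorem isoFrom_sound {n r c : ℕ} (k : ℕ) (q : List (ℕ × ℕ)) (h : isoFrom n r c k q = true) :
    ∃ σ : ℕ → ℕ, ∀ i < k, σ i < n ∧
      (∀ j < i, σ i ≠ σ j ∧ adj r j i = adj c (σ j) (σ i)) ∧
      ∀ p ∈ q, σ i ≠ p.2 ∧ adj r i p.1 = adj c (σ i) p.2 := by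
  induction k generalizing q with
  | zero => exact ⟨id, fun i hi => absurd hi (Nat.not_lt_zero i)⟩
  | succ k ih =>
    have h' : (anyBelow n fun x =>
      Nat.beq (popCount (row n r k)) (popCount (row n c x)) &&
      q.all (fun p => !Nat.beq x p.2 && (adj r k p.1 == adj c x p.2)) &&
      isoFrom n r c k ((k, x) :: q)) = true := h
    obtain ⟨x, hx, hx'⟩ := (anyBelow_iff _ _).mp h'
    simp only [Bool.and_eq_true, List.all_eq_true, Bool.not_eq_true', beq_iff_eq] at hx'
    obtain ⟨⟨-, hq⟩, hrec⟩ := hx'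
    obtain ⟨σ, hσ⟩ := ih _ hrec
    refine ⟨Function.update σ k x, fun i hi => ?_⟩
    rcases Nat.lt_succ_iff_lt_or_eq.mp hi with hik | rfl
    · rw [Function.update_of_ne hik.ne]
      obtain ⟨h1, h2, h3⟩ := hσ i hik
      refine ⟨h1, fun j hj => ?_, fun p hp => h3 p (List.mem_cons_of_mem _ hp)⟩
      rw [Function.update_of_ne (hj.trans hik).ne]
      exact h2 j hj
    · rw [Function.update_self]
      refine ⟨hx, fun j hj => ?_, fun p hp => ?_⟩
      · rw [Function.update_of_ne hj.ne]
        obtain ⟨h1, h2⟩ := (hσ j hj).2.2 _ List.mem_cons_self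
        exact ⟨h1.symm, h2⟩
      · obtain ⟨h1, h2⟩ := hq p hp
        exact ⟨fun h => by simp [h] at h1, h2⟩

/-- The empty column `n` leaves room for the next vertex. It is required only for `n < 8`, since the
position `8 * i + 8` already belongs to the following row. -/
theorem reps_valid : ∀ n ≤ 8, ∀ g ∈ reps n, g < 2 ^ (8 * n) ∧
    ∀ i < n, (n < 8 → adj g i n = false) ∧ adj g i i = false ∧ ∀ j < i, adj g i j = adj g j i := by
  decide +kernel

theorem Realizes.of_isoTest {V : Type*} {H : SimpleGraph V} {f : ℕ → V} {n r c : ℕ} (hn : n ≤ 8)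
    (hr : r ∈ reps n) (h : Realizes H f n c) (ht : isoTest n r c = true) :
    ∃ σ : ℕ → ℕ, (∀ i < n, σ i < n) ∧ Realizes H (f ∘ σ) n r := by
  rw [isoTest, Bool.and_eq_true] at ht
  obtain ⟨σ, hσ⟩ := isoFrom_sound n [] ht.2
  have hlt : ∀ i < n, ∀ j < i, adj r j i = true ↔ H.Adj (f (σ j)) (f (σ i)) := fun i hi j hj => by
    rw [((hσ i hi).2.1 j hj).2]
    exact h.adj_iff _ (hσ j (hj.trans hi)).1 _ (hσ i hi).1
  obtain ⟨-, hv⟩ := reps_valid n hn r hr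
  refine ⟨σ, fun i hi => (hσ i hi).1, fun i hi j hj hij => ?_, fun i hi j hj => ?_⟩
  · have e := h.inj _ (hσ i hi).1 _ (hσ j hj).1 hij
    rcases lt_trichotomy i j with hlt | rfl | hlt
    · exact absurd e.symm ((hσ j hj).2.1 i hlt).1
    · rfl
    · exact absurd e ((hσ i hi).2.1 j hlt).1
  · rcases lt_trichotomy i j with hij | rfl | hij
    · exact hlt j hj i hij
    · simp [(hv i hi).2.1]
    · rw [(hv i hi).2.2 j hij, hlt i hi j hij, Function.comp_apply, Function.comp_apply, H.adj_comm]

theorem exists_testBit_iff (n : ℕ) (p : ℕ → Prop) :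
    ∃ m < 2 ^ n, ∀ i < n, m.testBit i = true ↔ p i := by
  classical
  refine ⟨Nat.ofBits fun i : Fin n => decide (p i), Nat.ofBits_lt_two_pow _, fun i hi => ?_⟩
  rw [Nat.testBit_ofBits_lt _ _ hi]
  simp

theorem extensionTest_eq_true : ∀ n < 8, extensionTest n = true := by
  intro n hn
  interval_cases n
  exacts [extensionTest_0, extensionTest_1, extensionTest_2, extensionTest_3, extensionTest_4,
    extensionTest_5, extensionTest_6, extensionTest_7]

theorem exists_isoTest_extend {n g m : ℕ} (hn : n < 8) (hg : g ∈ reps n) (hm : m < 2 ^ n)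
    (h1 : degreeTest n g m = true) (h2 : diamondTest n g m = true) :
    ∃ r ∈ reps (n + 1), isoTest (n + 1) r (extend n g m) = true := by
  have h := (allBelow_iff _ _).mp (List.all_eq_true.mp (extensionTest_eq_true n hn) g hg) m hm
  rw [h1, h2, withValue_eq] at h
  simpa using h

section

variable {V : Type*} {H : SimpleGraph V} {f : ℕ → V} {n g : ℕ}

theorem Realizes.extend (hn : n ≤ 7) (hg : g ∈ reps n) (hf : Realizes H f n g) {w : V}
    (hw : ∀ i < n, f i ≠ w) {m : ℕ} (hm : m < 2 ^ n)
    (hmw : ∀ i < n, m.testBit i = true ↔ H.Adj w (f i)) :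
    Realizes H (Function.update f n w) (n + 1) (extend n g m) := by
  obtain ⟨hlt, hv⟩ := reps_valid n (by omega) g hg
  have hcol : ∀ i < n, adj g i n = false := fun i hi => (hv i hi).1 (by omega)
  have hmn : m.testBit n = false := Nat.testBit_lt_two_pow hm
  constructor
  · intro i hi j hj hij
    rcases Nat.lt_succ_iff_lt_or_eq.mp hi with hi | rfl <;>
      rcases Nat.lt_succ_iff_lt_or_eq.mp hj with hj | rfl
    · rw [Function.update_of_ne hi.ne, Function.update_of_ne hj.ne] at hij
      exact hf.inj i hi j hj hij
    · rw [Function.update_of_ne hi.ne, Function.update_self] at hij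
      exact absurd hij (hw i hi)
    · rw [Function.update_of_ne hj.ne, Function.update_self] at hij
      exact absurd hij.symm (hw j hj)
    · rfl
  · intro i hi j hj
    rw [adj_extend hn hlt hcol hm (Nat.lt_succ_iff.mp hi) (Nat.lt_succ_iff.mp hj)]
    rcases Nat.lt_succ_iff_lt_or_eq.mp hi with hi | rfl <;>
      rcases Nat.lt_succ_iff_lt_or_eq.mp hj with hj | rfl
    · rw [if_neg hi.ne, if_neg hj.ne, Function.update_of_ne hi.ne, Function.update_of_ne hj.ne]
      exact hf.adj_iff i hi j hj
    · rw [if_neg hi.ne, if_pos rfl, Function.update_of_ne hi.ne, Function.update_self, H.adj_comm]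
      exact hmw i hi
    · rw [if_pos rfl, Function.update_of_ne hj.ne, Function.update_self]
      exact hmw j hj
    · simp [hmn]

theorem Realizes.testBit_row (hf : Realizes H f n g) {i j : ℕ} (hi : i < n) (hj : j < n) :
    (row n g i).testBit j = true ↔ H.Adj (f i) (f j) := by
  rw [FlexibleGraphs.testBit_row, decide_eq_true hj, Bool.true_and]
  exact hf.adj_iff i hi j hj

theorem Realizes.diamondTest (hG : unicolorPairs H = ∅) (hf : Realizes H f n g) {w : V}
    (hw : ∀ i < n, f i ≠ w) {m : ℕ} (hm : m < 2 ^ n)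
    (hmw : ∀ i < n, m.testBit i = true ↔ H.Adj w (f i)) : diamondTest n g m = true := by
  refine (allBelow_iff _ _).mpr fun i hi => ?_
  rw [Bool.or_eq_true, bit_eq]
  by_cases hwi : m.testBit i = true
  swap
  · simp [hwi]
  refine Or.inr ((allBelow_iff _ _).mpr fun j hj => ?_)
  rw [bit_eq]
  by_cases hwj : m.testBit j = true
  swap
  · simp [hwj]
  by_cases hij : adj g i j = true
  swap
  · simp [hij]
  rw [Bool.or_eq_true]
  right
  have e : ∀ a b c d : ℕ, a &&& b ||| 2 ^ c = a &&& d →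
      Nat.beq (Nat.lor (Nat.land a b) (Nat.pow 2 c)) (Nat.land a d) = true :=
    fun a b c d h => by
        rw [Nat.beq_eq]
        exact h
  apply e
  refine Nat.eq_of_testBit_eq fun x => ?_
  rw [Nat.testBit_or, Nat.testBit_and, Nat.testBit_and, Nat.testBit_two_pow]
  rw [hmw i hi] at hwi
  rw [hmw j hj] at hwj
  rw [hf.adj_iff i hi j hj] at hij
  by_cases hx : x < n
  · rw [Bool.eq_iff_iff, Bool.or_eq_true, Bool.and_eq_true, Bool.and_eq_true, hf.testBit_row hi hx,
      hf.testBit_row hj hx, hmw x hx, decide_eq_true_iff]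
    constructor
    · rintro (⟨hix, hjx⟩ | rfl)
      · exact ⟨hix, (adj_of_adjacent_triangles hG hij hix.symm hjx.symm hwi hwj (hw x hx)).symm⟩
      · exact ⟨hij, hwj⟩
    · rintro ⟨hix, hwx⟩
      by_cases hjx : j = x
      · exact Or.inr hjx
      · exact Or.inl ⟨hix, adj_of_adjacent_triangles hG hwi hwj.symm hij.symm hwx.symm hix.symm
          fun h => hjx (hf.inj j hj x hx h)⟩
  · rw [not_lt] at hx
    have h1 := Nat.testBit_lt_two_pow (hm.trans_le (Nat.pow_le_pow_right (by norm_num) hx))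
    have h2 := Nat.testBit_lt_two_pow
      ((row_lt n g i).trans_le (Nat.pow_le_pow_right (by norm_num) hx))
    have h3 : j ≠ x := by omega
    simp [h1, h2, h3]

theorem Realizes.image_eq [DecidableEq V] (hf : Realizes H f n g) {W : Finset V}
    (hW : W.card = n) (hfW : ∀ i < n, f i ∈ W) : (Finset.range n).image f = W := by
  refine Finset.eq_of_subset_of_card_le (fun x hx => ?_) ?_
  · obtain ⟨i, hi, rfl⟩ := Finset.mem_image.mp hx
    exact hfW i (Finset.mem_range.mp hi)
  · rw [Finset.card_image_of_injOn, Finset.card_range, hW]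
    exact fun i hi j hj h => hf.inj i (by simpa using hi) j (by simpa using hj) h

open Classical in
theorem Realizes.popCount_eq (hn : n ≤ 8) (hf : Realizes H f n g) {W : Finset V}
    (hW : W.card = n) (hfW : ∀ i < n, f i ∈ W) {m : ℕ} (hm : m < 2 ^ n) {p : V → Prop}
    (hmp : ∀ i < n, m.testBit i = true ↔ p (f i)) : popCount m = (W.filter p).card := by
  rw [popCount_eq_card hn hm, ← hf.image_eq hW hfW, Finset.filter_image,
    Finset.card_image_of_injOn]
  · congr 1
    exact Finset.filter_congr fun i hi => hmp i (Finset.mem_range.mp hi)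
  · intro i hi j hj h
    simp only [Finset.coe_filter, Finset.mem_range, Set.mem_ofPred_eq] at hi hj
    exact hf.inj i hi.1 j hj.1 h

open Classical in
theorem Realizes.popCount_row (hn : n ≤ 8) (hf : Realizes H f n g) {W : Finset V}
    (hW : W.card = n) (hfW : ∀ i < n, f i ∈ W) {i : ℕ} (hi : i < n) :
    popCount (row n g i) = (W.filter (H.Adj (f i))).card :=
  hf.popCount_eq hn hW hfW (row_lt n g i) fun _ hj => hf.testBit_row hi hj

open Classical in
theorem Realizes.degreeTest (hn : n ≤ 7) (hf : Realizes H f n g) {W : Finset V} {w : V}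
    (hw : w ∈ W) (hW : (W.erase w).card = n) (hfW : ∀ i < n, f i ∈ W.erase w) {m : ℕ}
    (hm : m < 2 ^ n) (hmw : ∀ i < n, m.testBit i = true ↔ H.Adj w (f i))
    (hdeg : n - 4 ≤ (W.filter (H.Adj w)).card)
    (hmin : ∀ v ∈ W, (W.filter (H.Adj w)).card ≤ (W.filter (H.Adj v)).card) :
    degreeTest n g m = true := by
  have hins : insert w (W.erase w) = W := Finset.insert_erase hw
  have hcard : popCount m = (W.filter (H.Adj w)).card := by
    rw [hf.popCount_eq (by omega) hW hfW hm hmw]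
    conv_rhs => rw [← hins, Finset.filter_insert, if_neg (H.loopless.irrefl w)]
  refine Bool.and_eq_true_iff.mpr ⟨?_, (allBelow_iff _ _).mpr fun i hi => ?_⟩
  · rw [hcard]
    exact Nat.ble_eq.mpr hdeg
  · refine Nat.ble_eq.mpr ?_
    have hland : Nat.land 1 (Nat.shiftRight m i) = (m >>> i) % 2 := Nat.one_and_eq_mod_two _
    have hbit : (m >>> i) % 2 = (m.testBit i).toNat := by
      rw [Nat.testBit, Nat.one_and_eq_mod_two]
      rcases Nat.mod_two_eq_zero_or_one (m >>> i) with h | h <;> simp [h]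
    rw [hcard, hf.popCount_row (by omega) hW hfW hi, hland, hbit]
    refine (hmin (f i) (Finset.mem_of_mem_erase (hfW i hi))).trans ?_
    conv_lhs => rw [← hins, Finset.filter_insert]
    split_ifs with h
    · rw [(hmw i hi).mpr h.symm]
      exact Finset.card_insert_le _ _
    · exact Nat.le_add_right _ _

open Classical in
/-- Every induced subgraph with `n ≤ 8` vertices and minimum degree at least `n - 5` of a graph
without unicolor pairs has a code in the list. -/
theorem exists_realizes [Nonempty V] (hG : unicolorPairs H = ∅) (n : ℕ) (hn : n ≤ 8)
    (W : Finset V) (hW : W.card = n) (hdeg : ∀ w ∈ W, n - 5 ≤ (W.filter (H.Adj w)).card) :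
    ∃ g ∈ reps n, ∃ f : ℕ → V, Realizes H f n g ∧ ∀ i < n, f i ∈ W := by
  induction n generalizing W with
  | zero =>
    exact ⟨0, by simp [reps], fun _ => Classical.arbitrary V, ⟨by simp, by simp⟩, by simp⟩
  | succ n ih =>
    obtain ⟨w, hw, hmin⟩ := W.exists_min_image (fun w => (W.filter (H.Adj w)).card)
      (Finset.card_pos.mp (by omega))
    have hW' : (W.erase w).card = n := by rw [Finset.card_erase_of_mem hw, hW, Nat.add_sub_cancel]
    -- Removing `w` costs each remaining vertex at most one neighbor, and the required bound drops
    -- from $(n+1)-5$ to $n-5$ (in truncated subtraction).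
    obtain ⟨g, hg, f, hf, hfW⟩ := ih (by omega) (W.erase w) hW' fun v hv => by
      have h1 := hdeg v (Finset.mem_of_mem_erase hv)
      have h2 := Finset.pred_card_le_card_erase (s := W.filter (H.Adj v)) (a := w)
      rw [← Finset.filter_erase] at h2
      omega
    have hne : ∀ i < n, f i ≠ w := fun i hi => Finset.ne_of_mem_erase (hfW i hi)
    obtain ⟨m, hm, hmw⟩ := exists_testBit_iff n fun i => H.Adj w (f i)
    obtain ⟨r, hr, hiso⟩ := exists_isoTest_extend (by omega) hg hm
      (hf.degreeTest (by omega) hw hW' hfW hm hmw (by have := hdeg w hw; omega) hmin)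
      (hf.diamondTest hG hne hm hmw)
    obtain ⟨σ, hσ, hreal⟩ := (hf.extend (by omega) hg hne hm hmw).of_isoTest hn hr hiso
    refine ⟨r, hr, _, hreal, fun i hi => ?_⟩
    rw [Function.comp_apply]
    rcases Nat.lt_succ_iff_lt_or_eq.mp (hσ i hi) with h | h
    · rw [Function.update_of_ne h.ne]
      exact Finset.mem_of_mem_erase (hfW _ h)
    · rw [h, Function.update_self]
      exact hw

end

/-! ### Classification of the enumerated graphs -/

/-- Codes of the graphs in the classification. -/
def targets : ℕ → List ℕ
  | 6 =>
    [7726767290424, 21080053523754]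
  | 7 =>
    [1978051608475768, 14439075082294618, 16962454807000120]
  | 8 =>
    [506381209882392824, 1085102596360827120, 1095313046368865520, 7175811370759398600,
     8339770271637079434, 8771566117276829062, 8972161708569283696, 8337527267345534092,
     6459935990750400930, 4338031612937782602, 4196441995063431462, 6027323371913651400,
     8254690805633040690, 2241982140694700482, 6383876570140513578, 8693848901306438712]
  | _ => []

/-- The code of the graph in `adj_of_pattern`. -/
def patternCode : ℕ := 15838753938020662

set_option synthInstance.maxHeartbeats 400000 in
set_option synthInstance.maxSize 1000 in
-- The labelings in `reps` are chosen so that no embedding has to be searched: containment in a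
-- target is bitwise, a separating vertex is 0 with `1, …, k - 1` on one side, and the pattern
-- occupies `0, …, 6`. Rows have width 8 for every `n`, so `patternCode` can be compared with codes
-- on 7 and on 8 vertices.
theorem reps_classification : ∀ n ≤ 8, ∀ g ∈ reps n,
    (∃ i < n, popCount (row n g i) < 3) ∨
    (∀ i < n, ∀ j < n, i ≠ j → adj g i j = true) ∨
    (∃ t ∈ targets n, g &&& t = g) ∨
    (∃ k < n, 2 ≤ k ∧ ∀ i < k, 0 < i → ∀ j < n, k ≤ j → adj g i j = false) ∨
    (7 ≤ n ∧ patternCode &&& g = patternCode ∧ adj g 1 2 = false) := by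
  decide +kernel

theorem adj_of_land_eq {g t i j : ℕ} (h : g &&& t = g) (hg : adj g i j = true) :
    adj t i j = true := by
  rw [adj_eq] at hg ⊢
  rw [← h, Nat.testBit_and, Bool.and_eq_true] at hg
  exact hg.2

instance (n : ℕ) (E : List (Fin n × Fin n)) : DecidableRel (graphOfEdges n E).Adj := fun u v =>
  decidable_of_iff (u ≠ v ∧ ((u, v) ∈ E ∨ (v, u) ∈ E)) 
    (SimpleGraph.fromRel_adj (fun u v => (u, v) ∈ E) u v).symm

instance (a b : ℕ) : DecidableRel (completeBipartiteGraph (Fin a) (Fin b)).Adj := fun v w =>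
  inferInstanceAs (Decidable (v.isLeft ∧ w.isRight ∨ v.isRight ∧ w.isLeft))

section

variable {V : Type*} {H : SimpleGraph V} {n g : ℕ} {f : ℕ → V}

theorem Realizes.isSpanningSubgraphOf [Fintype V] {W : Type*} {T : SimpleGraph W} {t : ℕ}
    (hV : Fintype.card V = n) (hf : Realizes H f n g) (hgt : g &&& t = g) (e : Fin n ≃ W)
    (hT : ∀ i j : Fin n, adj t i j = true → T.Adj (e i) (e j)) : IsSpanningSubgraphOf H T := by
  have hinj : Function.Injective fun i : Fin n => f i :=
    fun i j hij => Fin.ext (hf.inj i i.2 j j.2 hij)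
  have hbij : Function.Bijective fun i : Fin n => f i :=
    (Fintype.bijective_iff_injective_and_card _).mpr ⟨hinj, by rw [Fintype.card_fin, hV]⟩
  refine ⟨(Equiv.ofBijective _ hbij).symm.trans e, fun u v huv => ?_⟩
  obtain ⟨i, rfl⟩ := (Equiv.ofBijective _ hbij).surjective u
  obtain ⟨j, rfl⟩ := (Equiv.ofBijective _ hbij).surjective v
  simp only [Equiv.trans_apply, Equiv.symm_apply_apply]
  exact hT i j (adj_of_land_eq hgt ((hf.adj_iff i i.2 j j.2).mpr huv))

theorem Realizes.exists_eq [Fintype V] (hV : Fintype.card V = n) (hf : Realizes H f n g) (v : V) :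
    ∃ i < n, f i = v := by
  classical
  have h := hf.image_eq (W := Finset.univ) (by rw [Finset.card_univ, hV])
    fun i _ => Finset.mem_univ (f i)
  have hv := Finset.mem_univ v
  rw [← h, Finset.mem_image] at hv
  obtain ⟨i, hi, rfl⟩ := hv
  exact ⟨i, Finset.mem_range.mp hi, rfl⟩

theorem Realizes.eq_top [Fintype V] (hV : Fintype.card V = n) (hf : Realizes H f n g)
    (h : ∀ i < n, ∀ j < n, i ≠ j → adj g i j = true) : H = ⊤ := by
  ext u v
  rw [SimpleGraph.top_adj]
  refine ⟨fun h => h.ne, fun huv => ?_⟩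
  obtain ⟨i, hi, rfl⟩ := hf.exists_eq hV u
  obtain ⟨j, hj, rfl⟩ := hf.exists_eq hV v
  exact (hf.adj_iff i hi j hj).mp (h i hi j hj fun e => huv (congrArg f e))

/-- In a graph with a spanning Laman subgraph, the first vertex does not separate the next `k - 1`
vertices from the others. -/
theorem Realizes.not_cut [Fintype V] (hV : Fintype.card V = n) (hf : Realizes H f n g)
    (hL : HasSpanningLamanSubgraph H) {k : ℕ} (hk : 2 ≤ k) (hkn : k < n) :
    ¬ ∀ i < k, 0 < i → ∀ j < n, k ≤ j → adj g i j = false := by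
  classical
  intro h
  obtain ⟨L, hLH, hL⟩ := hL
  have hcard : ∀ s : Finset ℕ, (∀ i ∈ s, i < n) → (s.image f).card = s.card := fun s hs =>
    Finset.card_image_of_injOn fun i hi j hj => hf.inj i (hs i hi) j (hs j hj)
  have hA : ((Finset.range k).image f).card = k := by
    rw [hcard _ fun i hi => (Finset.mem_range.mp hi).trans hkn, Finset.card_range]
  have hB : ((insert 0 (Finset.Ico k n)).image f).card = n - k + 1 := by
    rw [hcard, Finset.card_insert_of_notMem, Nat.card_Ico]
    · simp
      omega
    · intro i hi
      rcases Finset.mem_insert.mp hi with rfl | hi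
      · omega
      · exact (Finset.mem_Ico.mp hi).2
  have hmem : ∀ i < k, f i ∈ (Finset.range k).image f := fun i hi =>
    Finset.mem_image_of_mem f (Finset.mem_range.mpr hi)
  have hmem' : ∀ i < n, i = 0 ∨ k ≤ i → f i ∈ (insert 0 (Finset.Ico k n)).image f :=
    fun i hi h => Finset.mem_image_of_mem f (by
      rcases h with rfl | h
      · exact Finset.mem_insert_self _ _
      · exact Finset.mem_insert_of_mem (Finset.mem_Ico.mpr ⟨h, hi⟩))
  have hno : ∀ i < k, 0 < i → ∀ j < n, k ≤ j → ¬ H.Adj (f i) (f j) := fun i hi h0 j hj hkj => by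
    rw [← hf.adj_iff i (hi.trans hkn) j hj, h i hi h0 j hj hkj]
    simp
  -- The two sides share only `f 0`, so their sizes add up to $k+(n-k+1)=n+1$, one less than
  -- required.
  have := hL.card_add_two_le (A := (Finset.range k).image f)
    (B := (insert 0 (Finset.Ico k n)).image f) (by omega) (by omega) fun u v huv => by
      obtain ⟨i, hi, rfl⟩ := hf.exists_eq hV u
      obtain ⟨j, hj, rfl⟩ := hf.exists_eq hV v
      have huv := hLH huv
      by_cases hik : i < k <;> by_cases hjk : j < k
      · exact Or.inl ⟨hmem i hik, hmem j hjk⟩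
      · have : i = 0 := by
          by_contra h0
          exact hno i hik (Nat.pos_of_ne_zero h0) j hj (not_lt.mp hjk) huv
        exact Or.inr ⟨hmem' i hi (Or.inl this), hmem' j hj (Or.inr (not_lt.mp hjk))⟩
      · have : j = 0 := by
          by_contra h0
          exact hno j hjk (Nat.pos_of_ne_zero h0) i hi (not_lt.mp hik) huv.symm
        exact Or.inr ⟨hmem' i hi (Or.inr (not_lt.mp hik)), hmem' j hj (Or.inl this)⟩
      · exact Or.inr ⟨hmem' i hi (Or.inr (not_lt.mp hik)), hmem' j hj (Or.inr (not_lt.mp hjk))⟩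
  omega

theorem Realizes.adj_of_patternCode (hG : unicolorPairs H = ∅) (hn : 7 ≤ n) (hf : Realizes H f n g)
    (hg : patternCode &&& g = patternCode) : adj g 1 2 = true := by
  have h : ∀ i < 7, ∀ j < 7, adj patternCode i j = true → H.Adj (f i) (f j) := fun i hi j hj hij =>
    (hf.adj_iff i (by omega) j (by omega)).mp (adj_of_land_eq hg hij)
  have hne : ∀ i < 7, ∀ j < 7, i ≠ j → f i ≠ f j := fun i hi j hj hij e =>
    hij (hf.inj i (by omega) j (by omega) e)
  rw [hf.adj_iff 1 (by omega) 2 (by omega)]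
  refine adj_of_pattern hG (a := f 0) (b := f 1) (c := f 2) (d := f 3) (e := f 4) (f := f 5)
    (g := f 6) ?_ ?_ ?_ ?_ ?_ ?_ ?_ ?_ ?_ ?_ ?_ ?_ ?_ ?_ ?_ ?_ ?_ ?_ ?_ <;>
  first
  | exact h _ (by norm_num) _ (by norm_num) (by decide +kernel)
  | exact hne _ (by norm_num) _ (by norm_num) (by norm_num)

end

/-! ### Target codes compared with the listed graphs -/

theorem adj_completeBipartite_3_3 : ∀ i j : Fin 6, adj 7726767290424 i j = true →
    (completeBipartiteGraph (Fin 3) (Fin 3)).Adj ((finSumFinEquiv (m := 3) (n := 3)).symm i)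
      ((finSumFinEquiv (m := 3) (n := 3)).symm j) := by
  decide +kernel

theorem adj_graphL1 : ∀ i j : Fin 6, adj 21080053523754 i j = true → graphL1.Adj i j := by
  unfold graphL1
  decide +kernel

theorem adj_completeBipartite_3_4 : ∀ i j : Fin 7, adj 1978051608475768 i j = true →
    (completeBipartiteGraph (Fin 3) (Fin 4)).Adj ((finSumFinEquiv (m := 3) (n := 4)).symm i)
      ((finSumFinEquiv (m := 3) (n := 4)).symm j) := by
  decide +kernel

theorem adj_graphL2 : ∀ i j : Fin 7, adj 14439075082294618 i j = true → graphL2.Adj i j := by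
  unfold graphL2
  decide +kernel

theorem adj_graphQ1 : ∀ i j : Fin 7, adj 16962454807000120 i j = true → graphQ1.Adj i j := by
  unfold graphQ1
  decide +kernel

theorem adj_completeBipartite_3_5 : ∀ i j : Fin 8, adj 506381209882392824 i j = true →
    (completeBipartiteGraph (Fin 3) (Fin 5)).Adj ((finSumFinEquiv (m := 3) (n := 5)).symm i)
      ((finSumFinEquiv (m := 3) (n := 5)).symm j) := by
  decide +kernel

theorem adj_completeBipartite_4_4 : ∀ i j : Fin 8, adj 1085102596360827120 i j = true →
    (completeBipartiteGraph (Fin 4) (Fin 4)).Adj ((finSumFinEquiv (m := 4) (n := 4)).symm i)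
      ((finSumFinEquiv (m := 4) (n := 4)).symm j) := by
  decide +kernel

theorem adj_graphL3 : ∀ i j : Fin 8, adj 1095313046368865520 i j = true → graphL3.Adj i j := by
  unfold graphL3
  decide +kernel

theorem adj_graphL4 : ∀ i j : Fin 8, adj 7175811370759398600 i j = true → graphL4.Adj i j := by
  unfold graphL4
  decide +kernel

theorem adj_graphL5 : ∀ i j : Fin 8, adj 8339770271637079434 i j = true → graphL5.Adj i j := by
  unfold graphL5
  decide +kernel

theorem adj_graphL6 : ∀ i j : Fin 8, adj 8771566117276829062 i j = true → graphL6.Adj i j := by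
  unfold graphL6
  decide +kernel

theorem adj_graphQ2 : ∀ i j : Fin 8, adj 8972161708569283696 i j = true → graphQ2.Adj i j := by
  unfold graphQ2
  decide +kernel

theorem adj_graphQ3 : ∀ i j : Fin 8, adj 8337527267345534092 i j = true → graphQ3.Adj i j := by
  unfold graphQ3
  decide +kernel

theorem adj_graphQ4 : ∀ i j : Fin 8, adj 6459935990750400930 i j = true → graphQ4.Adj i j := by
  unfold graphQ4
  decide +kernel

theorem adj_graphQ5 : ∀ i j : Fin 8, adj 4338031612937782602 i j = true → graphQ5.Adj i j := by
  unfold graphQ5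
  decide +kernel

theorem adj_graphQ6 : ∀ i j : Fin 8, adj 4196441995063431462 i j = true → graphQ6.Adj i j := by
  unfold graphQ6
  decide +kernel

theorem adj_graphS1 : ∀ i j : Fin 8, adj 6027323371913651400 i j = true → graphS1.Adj i j := by
  unfold graphS1
  decide +kernel

theorem adj_graphS2 : ∀ i j : Fin 8, adj 8254690805633040690 i j = true → graphS2.Adj i j := by
  unfold graphS2
  decide +kernel

theorem adj_graphS3 : ∀ i j : Fin 8, adj 2241982140694700482 i j = true → graphS3.Adj i j := by
  unfold graphS3
  decide +kernel

theorem adj_graphS4 : ∀ i j : Fin 8, adj 6383876570140513578 i j = true → graphS4.Adj i j := by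
  unfold graphS4
  decide +kernel

theorem adj_graphS5 : ∀ i j : Fin 8, adj 8693848901306438712 i j = true → graphS5.Adj i j := by
  unfold graphS5
  decide +kernel

end FlexibleGraphs

theorem mainTheorem5 {V : Type*} [Fintype V] (G : SimpleGraph V)
    (hcard : Fintype.card V ≤ 8)
    (hLaman : FlexibleGraphs.HasSpanningLamanSubgraph G)
    (hdeg : ∀ v : V, ((FlexibleGraphs.constantDistanceClosure G).neighborSet v).ncard ≠ 2)
    (hnoncomplete : FlexibleGraphs.constantDistanceClosure G ≠ ⊤) :
    FlexibleGraphs.IsSpanningSubgraphOf (FlexibleGraphs.constantDistanceClosure G)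
      (completeBipartiteGraph (Fin 3) (Fin 3)) ∨
    FlexibleGraphs.IsSpanningSubgraphOf (FlexibleGraphs.constantDistanceClosure G)
      (completeBipartiteGraph (Fin 3) (Fin 4)) ∨
    FlexibleGraphs.IsSpanningSubgraphOf (FlexibleGraphs.constantDistanceClosure G)
      (completeBipartiteGraph (Fin 3) (Fin 5)) ∨
    FlexibleGraphs.IsSpanningSubgraphOf (FlexibleGraphs.constantDistanceClosure G)
      (completeBipartiteGraph (Fin 4) (Fin 4)) ∨
    FlexibleGraphs.IsSpanningSubgraphOf (FlexibleGraphs.constantDistanceClosure G)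
      FlexibleGraphs.graphL1 ∨
    FlexibleGraphs.IsSpanningSubgraphOf (FlexibleGraphs.constantDistanceClosure G)
      FlexibleGraphs.graphL2 ∨
    FlexibleGraphs.IsSpanningSubgraphOf (FlexibleGraphs.constantDistanceClosure G)
      FlexibleGraphs.graphL3 ∨
    FlexibleGraphs.IsSpanningSubgraphOf (FlexibleGraphs.constantDistanceClosure G)
      FlexibleGraphs.graphL4 ∨
    FlexibleGraphs.IsSpanningSubgraphOf (FlexibleGraphs.constantDistanceClosure G)
      FlexibleGraphs.graphL5 ∨
    FlexibleGraphs.IsSpanningSubgraphOf (FlexibleGraphs.constantDistanceClosure G)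
      FlexibleGraphs.graphL6 ∨
    FlexibleGraphs.IsSpanningSubgraphOf (FlexibleGraphs.constantDistanceClosure G)
      FlexibleGraphs.graphQ1 ∨
    FlexibleGraphs.IsSpanningSubgraphOf (FlexibleGraphs.constantDistanceClosure G)
      FlexibleGraphs.graphQ2 ∨
    FlexibleGraphs.IsSpanningSubgraphOf (FlexibleGraphs.constantDistanceClosure G)
      FlexibleGraphs.graphQ3 ∨
    FlexibleGraphs.IsSpanningSubgraphOf (FlexibleGraphs.constantDistanceClosure G)
      FlexibleGraphs.graphQ4 ∨
    FlexibleGraphs.IsSpanningSubgraphOf (FlexibleGraphs.constantDistanceClosure G)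
      FlexibleGraphs.graphQ5 ∨
    FlexibleGraphs.IsSpanningSubgraphOf (FlexibleGraphs.constantDistanceClosure G)
      FlexibleGraphs.graphQ6 ∨
    FlexibleGraphs.IsSpanningSubgraphOf (FlexibleGraphs.constantDistanceClosure G)
      FlexibleGraphs.graphS1 ∨
    FlexibleGraphs.IsSpanningSubgraphOf (FlexibleGraphs.constantDistanceClosure G)
      FlexibleGraphs.graphS2 ∨
    FlexibleGraphs.IsSpanningSubgraphOf (FlexibleGraphs.constantDistanceClosure G)
      FlexibleGraphs.graphS3 ∨
    FlexibleGraphs.IsSpanningSubgraphOf (FlexibleGraphs.constantDistanceClosure G)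
      FlexibleGraphs.graphS4 ∨
    FlexibleGraphs.IsSpanningSubgraphOf (FlexibleGraphs.constantDistanceClosure G)
      FlexibleGraphs.graphS5 := by
  obtain ⟨L, hLG, hL⟩ := hLaman
  have hGH := FlexibleGraphs.le_constantDistanceClosure G
  have hH := FlexibleGraphs.unicolorPairs_constantDistanceClosure G
  -- From here on only `hGH`, `hH` and the hypotheses on degrees and noncompleteness are known about
  -- the closure.
  generalize FlexibleGraphs.constantDistanceClosure G = H at *
  classical
  have h3 : 3 ≤ Fintype.card V := hL.three_le_card fun h =>
    hnoncomplete (top_le_iff.mp (h ▸ hLG.trans hGH))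
  have hdeg' : ∀ v, 3 ≤ (Finset.univ.filter (H.Adj v)).card := fun v => by
    have h1 := hL.two_le_card_adj h3 v
    have h2 : (Finset.univ.filter (L.Adj v)).card ≤ (Finset.univ.filter (H.Adj v)).card :=
      Finset.card_le_card (Finset.monotone_filter_right _ fun w _ h => hGH (hLG h))
    have h4 : (H.neighborSet v).ncard = (Finset.univ.filter (H.Adj v)).card := by
      rw [← Set.ncard_coe_finset]
      congr 1
      ext w
      simp
    have h5 := hdeg v
    omega
  have : Nonempty V := Fintype.card_pos_iff.mp (by omega)
  -- With at most 8 vertices, the threshold $|V|-5$ is at most 3, so the degree bound just proved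
  -- suffices.
  obtain ⟨g, hg, f, hf, -⟩ := FlexibleGraphs.exists_realizes hH (Fintype.card V) hcard Finset.univ
    Finset.card_univ fun w _ => le_trans (by omega) (hdeg' w)
  obtain ⟨n, hn⟩ : ∃ n, Fintype.card V = n := ⟨_, rfl⟩
  rw [hn] at hg hf hcard
  rcases FlexibleGraphs.reps_classification n hcard g hg with
    ⟨i, hi, h⟩ | h | ⟨t, ht, hgt⟩ | ⟨k, hkn, hk, h⟩ | ⟨h7, hpat, h12⟩
  · have := hdeg' (f i)
    rw [hf.popCount_row hcard (W := Finset.univ) (by rw [Finset.card_univ, hn])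
      (fun _ _ => Finset.mem_univ _) hi] at h
    omega
  · exact absurd (hf.eq_top hn h) hnoncomplete
  · have hn3 : 3 ≤ n := hn ▸ h3
    interval_cases n
    · simp [FlexibleGraphs.targets] at ht
    · simp [FlexibleGraphs.targets] at ht
    · simp [FlexibleGraphs.targets] at ht
    · simp only [FlexibleGraphs.targets, List.mem_cons, List.not_mem_nil, or_false] at ht
      rcases ht with rfl | rfl
      · have := hf.isSpanningSubgraphOf hn hgt (finSumFinEquiv (m := 3) (n := 3)).symm
          FlexibleGraphs.adj_completeBipartite_3_3
        simp only [this, true_or, or_true]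
      · have := hf.isSpanningSubgraphOf hn hgt (Equiv.refl _) FlexibleGraphs.adj_graphL1
        simp only [this, true_or, or_true]
    · simp only [FlexibleGraphs.targets, List.mem_cons, List.not_mem_nil, or_false] at ht
      rcases ht with rfl | rfl | rfl
      · have := hf.isSpanningSubgraphOf hn hgt (finSumFinEquiv (m := 3) (n := 4)).symm
          FlexibleGraphs.adj_completeBipartite_3_4
        simp only [this, true_or, or_true]
      · have := hf.isSpanningSubgraphOf hn hgt (Equiv.refl _) FlexibleGraphs.adj_graphL2
        simp only [this, true_or, or_true]
      · have := hf.isSpanningSubgraphOf hn hgt (Equiv.refl _) FlexibleGraphs.adj_graphQ1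
        simp only [this, true_or, or_true]
    · simp only [FlexibleGraphs.targets, List.mem_cons, List.not_mem_nil, or_false] at ht
      rcases ht with rfl | rfl | rfl | rfl | rfl | rfl | rfl | rfl | rfl | rfl | rfl | rfl | rfl | rfl | rfl | rfl
      · have := hf.isSpanningSubgraphOf hn hgt (finSumFinEquiv (m := 3) (n := 5)).symm
          FlexibleGraphs.adj_completeBipartite_3_5
        simp only [this, true_or, or_true]
      · have := hf.isSpanningSubgraphOf hn hgt (finSumFinEquiv (m := 4) (n := 4)).symm
          FlexibleGraphs.adj_completeBipartite_4_4
        simp only [this, true_or, or_true]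
      · have := hf.isSpanningSubgraphOf hn hgt (Equiv.refl _) FlexibleGraphs.adj_graphL3
        simp only [this, true_or, or_true]
      · have := hf.isSpanningSubgraphOf hn hgt (Equiv.refl _) FlexibleGraphs.adj_graphL4
        simp only [this, true_or, or_true]
      · have := hf.isSpanningSubgraphOf hn hgt (Equiv.refl _) FlexibleGraphs.adj_graphL5
        simp only [this, true_or, or_true]
      · have := hf.isSpanningSubgraphOf hn hgt (Equiv.refl _) FlexibleGraphs.adj_graphL6
        simp only [this, true_or, or_true]
      · have := hf.isSpanningSubgraphOf hn hgt (Equiv.refl _) FlexibleGraphs.adj_graphQ2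
        simp only [this, true_or, or_true]
      · have := hf.isSpanningSubgraphOf hn hgt (Equiv.refl _) FlexibleGraphs.adj_graphQ3
        simp only [this, true_or, or_true]
      · have := hf.isSpanningSubgraphOf hn hgt (Equiv.refl _) FlexibleGraphs.adj_graphQ4
        simp only [this, true_or, or_true]
      · have := hf.isSpanningSubgraphOf hn hgt (Equiv.refl _) FlexibleGraphs.adj_graphQ5
        simp only [this, true_or, or_true]
      · have := hf.isSpanningSubgraphOf hn hgt (Equiv.refl _) FlexibleGraphs.adj_graphQ6
        simp only [this, true_or, or_true]
      · have := hf.isSpanningSubgraphOf hn hgt (Equiv.refl _) FlexibleGraphs.adj_graphS1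
        simp only [this, true_or, or_true]
      · have := hf.isSpanningSubgraphOf hn hgt (Equiv.refl _) FlexibleGraphs.adj_graphS2
        simp only [this, true_or, or_true]
      · have := hf.isSpanningSubgraphOf hn hgt (Equiv.refl _) FlexibleGraphs.adj_graphS3
        simp only [this, true_or, or_true]
      · have := hf.isSpanningSubgraphOf hn hgt (Equiv.refl _) FlexibleGraphs.adj_graphS4
        simp only [this, true_or, or_true]
      · have := hf.isSpanningSubgraphOf hn hgt (Equiv.refl _) FlexibleGraphs.adj_graphS5
        simp only [this, or_true]
  · exact absurd h (hf.not_cut hn ⟨L, hLG.trans hGH, hL⟩ hk hkn)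
  · rw [hf.adj_of_patternCode hH h7 hpat] at h12
    exact absurd h12 (by simp)
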